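/- Work in $\mathbb{Z}[q]$. For integers $n\ge 0$ put $[n]_q = 1+q+\cdots+q^{n-1}$ (so $[0]_q=0$) and $[n]_q! = \prod_{j=1}^{n}[j]_q$ (so $[0]_q!=1$), and for $n,k\geq 0$ let $$\binom{n}{k}_q=\frac{[n]_q!}{[k]_q!\,[n-k]_q!}\in\mathbb{Z}[q]\quad (k\le n),\qquad \binom{n}{k}_q=0\quad (k>n)$$ be the $q$-binomial coefficient. Let $\mathsf F(q)=(f_{n,k}(q))_{n,k\ge 0}$ be the infinite matrix with $$f_{n,k}(q)=\begin{cases}\delta_{nk} & \text{if } k=0,\\ \binom{n-1}{k-1}_q\,([n]_q)^{n-k} & \text{if } n\ge k\ge 1,\\ 0 & \text{otherwise,}\end{cases}$$ where $\delta_{nk}$ is the Kronecker delta, and let $\mathsf T(q)=(t_{n,k}(q))_{n,k\ge 0}$ be the infinite matrix with $t_{n,k}(q)=\binom{n}{k}_q([n]_q)^{n-k}$ if $n\ge k\ge 0$ and $t_{n,k}(q)=0$ if $k>n$ (here $([0]_q)^0=1$). **Theorem.** The matrices $\mathsf F(q)$ and $\mathsf T(q)$ are coefficientwise totally positive: for every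 $r\ge 0$ and all row indices $0\le i_1<\cdots<i_r$ and column indices $0\le j_1<\cdots<j_r$, the minors $\det\big(f_{i_a,j_b}(q)\big)_{1\le a,b\le r}$ and $\det\big(t_{i_a,j_b}(q)\big)_{1\le a,b\le r}$ are polynomials in $q$ all of whose coefficients are nonnegative. -/

import Mathlib

open Polynomial

noncomputable section

namespace QForests

/-- The `q`-integer `[n]_q = 1 + q + ⋯ + q^(n-1)` in `ℤ[q]`, the indeterminate `q` being `X`;
in particular `[0]_q = 0`. -/
def qInt (n : ℕ) : ℤ[X] := ∑ i ∈ Finset.range n, X ^ i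

/-- The `q`-factorial `[n]_q! = [1]_q [2]_q ⋯ [n]_q`, with `[0]_q! = 1`. -/
def qFactorial (n : ℕ) : ℤ[X] := ∏ j ∈ Finset.Icc 1 n, qInt j

/-- The `q`-binomial coefficient `[n]_q! / ([k]_q! [n-k]_q!)` for `k ≤ n`, and `0` for `k > n`.
The denominator is monic (`monic_qFactorial`) and the division is exact (`qBinom_mul`). -/
def qBinom (n k : ℕ) : ℤ[X] :=
  if k ≤ n then qFactorial n /ₘ (qFactorial k * qFactorial (n - k)) else 0

/-- The `q`-forests matrix, with rows and columns indexed by `0, 1, 2, …`. -/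
def qForests : Matrix ℕ ℕ ℤ[X] := Matrix.of fun n k =>
  if k = 0 then (if n = k then 1 else 0)
  else if k ≤ n then qBinom (n - 1) (k - 1) * qInt n ^ (n - k)
  else 0

/-- The `q`-trees matrix, with rows and columns indexed by `0, 1, 2, …`; the entries with `k > n`
vanish because `qBinom n k` does. -/
def qTrees : Matrix ℕ ℕ ℤ[X] := Matrix.of fun n k => qBinom n k * qInt n ^ (n - k)

/-- A polynomial is nonnegative in the coefficientwise order if all its coefficients are. -/
def CoeffNonneg (p : ℤ[X]) : Prop := ∀ i : ℕ, 0 ≤ p.coeff i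

/-- A matrix over `ℤ[q]` with rows and columns indexed by `ℕ` is coefficientwise totally positive
if all its minors (with rows `i 0 < i 1 < ⋯` and columns `j 0 < j 1 < ⋯`, of every finite size)
are polynomials with nonnegative coefficients. -/
def CoeffTotallyPositive (M : Matrix ℕ ℕ ℤ[X]) : Prop :=
  ∀ (r : ℕ) (i j : Fin r → ℕ), StrictMono i → StrictMono j →
    CoeffNonneg (M.submatrix i j).det

/-! The denominators in `qBinom` are monic and the quotients are exact. -/

theorem qFactorial_succ (n : ℕ) : qFactorial (n + 1) = qFactorial n * qInt (n + 1) := by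
  simp [qFactorial, Finset.prod_Icc_succ_top]

theorem monic_qFactorial (n : ℕ) : (qFactorial n).Monic := by
  refine monic_prod_of_monic _ _ fun j hj => ?_
  have h := (Finset.mem_Icc.1 hj).1
  exact monic_geom_sum_X (by omega)

theorem qInt_add (a b : ℕ) : qInt (a + b) = qInt a + X ^ a * qInt b := by
  simp [qInt, Finset.sum_range_add, pow_add, Finset.mul_sum]

theorem qFactorial_dvd (a b : ℕ) : qFactorial a * qFactorial b ∣ qFactorial (a + b) := by
  induction h : a + b generalizing a b with
  | zero =>
    obtain ⟨rfl, rfl⟩ : a = 0 ∧ b = 0 := by omega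
    simp [qFactorial]
  | succ n ih =>
    rcases a with _ | a
    · obtain rfl : b = n + 1 := by omega
      simp [qFactorial]
    rcases b with _ | b
    · obtain rfl : a = n := by omega
      simp [qFactorial]
    obtain ⟨c, hc⟩ := ih a (b + 1) (by omega)
    obtain ⟨d, hd⟩ := ih (a + 1) b (by omega)
    refine ⟨c + X ^ (a + 1) * d, ?_⟩
    have e : qInt (n + 1) = qInt (a + 1) + X ^ (a + 1) * qInt (b + 1) := by
      rw [← qInt_add, h]
    rw [qFactorial_succ n, e, mul_add]
    nth_rewrite 1 [hc]
    rw [hd]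
    simp only [qFactorial_succ]
    ring

theorem qBinom_mul {n k : ℕ} (h : k ≤ n) :
    qFactorial k * qFactorial (n - k) * qBinom n k = qFactorial n := by
  have hm := (monic_qFactorial k).mul (monic_qFactorial (n - k))
  have hd := qFactorial_dvd k (n - k)
  rw [Nat.add_sub_cancel' h] at hd
  have := modByMonic_add_div (qFactorial n) (qFactorial k * qFactorial (n - k))
  rw [(modByMonic_eq_zero_iff_dvd hm).2 hd, zero_add] at this
  rw [qBinom, if_pos h, this]

end QForests

end

/-!
Both matrices belong to a two-parameter family: for coefficientwise nonnegative `y` and `z` let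
`T(y, z)` have the entries `binom(n, k)_q (y + z [n]_q) ^ (n - k)`, and let `F(y, z)` arise from it
by subtracting `z q ^ k [k + 1]_q` times column `k + 1` from each column `k`. Then the `q`-trees
matrix is `T(0, 1)` and the `q`-forests matrix is `F(0, 1)`. The first row of `F(y, z)` is a unit
vector, and row `n + 1` is the image of row `n` of `T(y + z, z q)` under a nonnegative upper
bidiagonal matrix. Nonnegative bidiagonal matrices, and the inverses of unipotent ones with
nonpositive off-diagonal entries, preserve total positivity, so that induction on the number of
rows shows all `F(y, z)` and `T(y, z)` to be totally positive.
-/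

namespace QForests

open Finset
open scoped Matrix

section TotalPositivity

variable {A : Type*} [CommRing A] {P : Subsemiring A}

/-- Total positivity of a matrix, where the elements of the subsemiring `P` take the role of the
nonnegative elements. -/
def IsTotallyPositive {m n : Type*} [Preorder m] [Preorder n] (P : Subsemiring A)
    (M : Matrix m n A) : Prop :=
  ∀ ⦃r : ℕ⦄ ⦃i : Fin r → m⦄ ⦃j : Fin r → n⦄, StrictMono i → StrictMono j →
    (M.submatrix i j).det ∈ P

theorem det_sum_columns {m n : Type*} [Fintype m] [DecidableEq m] (M : Matrix m n A)
    (s : m → Finset n) (c : m → n → A) :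
    (Matrix.of fun a b => ∑ x ∈ s b, c b x * M a x).det =
      ∑ f ∈ Fintype.piFinset s, (∏ b, c b (f b)) * (M.submatrix id f).det := by
  have hrows : (Matrix.of fun a b => ∑ x ∈ s b, c b x * M a x)ᵀ =
      fun b => ∑ x ∈ s b, c b x • Mᵀ x := by
    ext b a
    simp
  rw [← Matrix.det_transpose, hrows]
  refine (Matrix.detRowAlternating.toMultilinearMap.map_sum_finset _ s).trans
    (sum_congr rfl fun f _ => ?_)
  rw [← Matrix.det_transpose (M.submatrix id f)]
  exact Matrix.detRowAlternating.toMultilinearMap.map_smul_univ _ _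

namespace IsTotallyPositive

theorem det_submatrix_mem_of_monotone {m n : Type*} [Preorder m] [PartialOrder n]
    {M : Matrix m n A} (hM : IsTotallyPositive P M) {r : ℕ} {i : Fin r → m} {j : Fin r → n}
    (hi : StrictMono i) (hj : Monotone j) : (M.submatrix i j).det ∈ P := by
  by_cases hinj : Function.Injective j
  · exact hM hi (hj.strictMono_of_injective hinj)
  · obtain ⟨a, b, hab, hne⟩ := Function.not_injective_iff.1 hinj
    rw [Matrix.det_zero_of_column_eq hne fun k => by simp only [Matrix.submatrix_apply, hab]]
    exact P.zero_mem

theorem of_interlacing_columns {m n n' : Type*} [Preorder m] [PartialOrder n] [Preorder n']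
    {M : Matrix m n A} {N : Matrix m n' A} (hM : IsTotallyPositive P M) {s : n' → Finset n}
    (hs : ∀ ⦃k l⦄, k < l → ∀ x ∈ s k, ∀ y ∈ s l, x ≤ y) {c : n' → n → A}
    (hc : ∀ k, ∀ x ∈ s k, c k x ∈ P) (hN : ∀ a k, N a k = ∑ x ∈ s k, c k x * M a x) :
    IsTotallyPositive P N := by
  intro r i j hi hj
  have hsub : N.submatrix i j =
      Matrix.of fun a b => ∑ x ∈ s (j b), c (j b) x * M.submatrix i id a x :=
    Matrix.ext fun a b => hN (i a) (j b)
  -- Only minors of `M` with weakly increasing column indices occur in the multilinear expansion.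
  rw [hsub, det_sum_columns (M.submatrix i id) (fun b => s (j b)) fun b => c (j b)]
  refine P.sum_mem fun f hf => ?_
  have hf' := Fintype.mem_piFinset.1 hf
  have hmono : Monotone f := monotone_iff_forall_lt.2 fun a b hab =>
    hs (hj hab) _ (hf' a) _ (hf' b)
  exact P.mul_mem (P.prod_mem fun b _ => hc _ _ (hf' b)) (hM.det_submatrix_mem_of_monotone hi hmono)

theorem of_lower_bidiagonal {m : Type*} [Preorder m] {M N : Matrix m ℕ A}
    (hM : IsTotallyPositive P M) {c : ℕ → A} (hc : ∀ k, c k ∈ P)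
    (hN : ∀ a k, N a k = M a k + c k * M a (k + 1)) : IsTotallyPositive P N := by
  refine hM.of_interlacing_columns (s := fun k => {k, k + 1})
    (c := fun k x => if x = k then 1 else c k) (fun k l hkl x hx y hy => ?_) (fun k x _ => ?_)
    fun a k => ?_
  · simp only [mem_insert, mem_singleton] at hx hy
    lia
  · split_ifs
    exacts [P.one_mem, hc k]
  · simp [hN]

theorem of_upper_bidiagonal {m : Type*} [Preorder m] {M N : Matrix m ℕ A}
    (hM : IsTotallyPositive P M) {c : ℕ → A} (hc : ∀ k, c k ∈ P)
    (hN_zero : ∀ a, N a 0 = c 0 * M a 0)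
    (hN_succ : ∀ a k, N a (k + 1) = M a k + c (k + 1) * M a (k + 1)) :
    IsTotallyPositive P N := by
  refine hM.of_interlacing_columns (s := fun k => {k - 1, k})
    (c := fun k x => if x = k then c k else 1) (fun k l hkl x hx y hy => ?_) (fun k x _ => ?_)
    fun a k => ?_
  · simp only [mem_insert, mem_singleton] at hx hy
    lia
  · split_ifs
    exacts [hc k, P.one_mem]
  · cases k <;> simp [hN_zero, hN_succ]

theorem of_inverse_lower_bidiagonal {m : Type*} [Preorder m] {M N : Matrix m ℕ A}
    (hM : IsTotallyPositive P M) {c : ℕ → A} (hc : ∀ k, c k ∈ P) {K : ℕ}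
    (hK : ∀ a, ∀ k ≥ K, N a k = 0) (hN : ∀ a k, N a k = M a k + c k * N a (k + 1)) :
    IsTotallyPositive P N := by
  -- From right to left, each replacement of a column of `M` by that of `N` is a bidiagonal step.
  have hybrid : ∀ t ≤ K,
      IsTotallyPositive P (Matrix.of fun a k => if t ≤ k then N a k else M a k) := by
    intro t ht
    induction ht using Nat.decreasingInduction with
    | self =>
      convert hM using 1
      ext a k
      rw [Matrix.of_apply, ite_eq_right_iff, hN]
      intro hk
      rw [hK a (k + 1) (by lia), mul_zero, add_zero]
    | of_succ t _ ih =>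
      refine ih.of_lower_bidiagonal (c := Pi.single t (c t)) (fun k => ?_) fun a k => ?_
      · rcases eq_or_ne k t with rfl | hk
        · simpa using hc k
        · simp [hk, P.zero_mem]
      · rcases lt_trichotomy k t with hk | rfl | hk
        · simp [hk.ne, hk.not_ge, hk.not_gt]
        · simp [hN a k]
        · simp [hk, hk.ne', hk.le]
  have hN_hybrid : N = Matrix.of fun a k => if 0 ≤ k then N a k else M a k := by
    ext a k
    simp
  exact hN_hybrid ▸ hybrid 0 K.zero_le

theorem of_row_zero_eq_single {n : Type*} [PartialOrder n] [OrderBot n] [DecidableEq n] {R : ℕ}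
    {M : Matrix (Fin (R + 1)) n A} (h_zero : M 0 = Pi.single ⊥ 1)
    (h_succ : IsTotallyPositive P (M.submatrix Fin.succ id)) : IsTotallyPositive P M := by
  have avoiding_zero {r : ℕ} {i : Fin r → Fin (R + 1)} {j : Fin r → n} (hi : StrictMono i)
      (hj : StrictMono j) (hpos : ∀ a, i a ≠ 0) : (M.submatrix i j).det ∈ P := by
    have hsub : M.submatrix i j =
        (M.submatrix Fin.succ id).submatrix (fun a => (i a).pred (hpos a)) j := by
      ext a b
      simp
    rw [hsub]
    exact h_succ (fun a b hab => Fin.pred_lt_pred_iff.2 (hi hab)) hj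
  intro r i j hi hj
  rcases r with _ | r
  · simp [P.one_mem]
  by_cases hi0 : i 0 = 0
  · have hbot (b : Fin r) : j b.succ ≠ ⊥ := (bot_le.trans_lt (hj b.succ_pos)).ne'
    rw [Matrix.det_succ_row_zero, Fin.sum_univ_succ,
      sum_eq_zero fun b _ => by simp [hi0, h_zero, hbot b], Matrix.submatrix_submatrix]
    simp only [Fin.val_zero, pow_zero, one_mul, add_zero, Matrix.submatrix_apply, hi0, h_zero]
    refine P.mul_mem ?_ (avoiding_zero (hi.comp Fin.strictMono_succ)
      (hj.comp (Fin.strictMono_succAbove 0)) fun a => ?_)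
    · rw [Pi.single_apply]
      split_ifs
      exacts [P.one_mem, P.zero_mem]
    · exact ((Fin.zero_le _).trans_lt (hi a.succ_pos)).ne'
  · exact avoiding_zero hi hj fun a =>
      ((Fin.pos_iff_ne_zero.2 hi0).trans_le (hi.monotone a.zero_le)).ne'

theorem of_initial_rows {n : Type*} [Preorder n] {M : Matrix ℕ n A}
    (h : ∀ R : ℕ, IsTotallyPositive P (M.submatrix (Fin.val : Fin R → ℕ) id)) :
    IsTotallyPositive P M := by
  intro r i j hi hj
  have hlt (a : Fin r) : i a < univ.sup i + 1 := Nat.lt_succ_of_le (le_sup (mem_univ a))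
  exact h _ (i := fun a => ⟨i a, hlt a⟩) (fun a b hab => hi hab) hj

end IsTotallyPositive

end TotalPositivity

namespace CoeffNonneg

theorem zero : CoeffNonneg 0 := fun _ => le_rfl

theorem one : CoeffNonneg 1 := fun i => by
  rw [coeff_one]
  split_ifs <;> decide

theorem X_pow (n : ℕ) : CoeffNonneg (X ^ n) := fun i => by
  rw [coeff_X_pow]
  split_ifs <;> decide

theorem add {p q : ℤ[X]} (hp : CoeffNonneg p) (hq : CoeffNonneg q) : CoeffNonneg (p + q) :=
  fun i => by
    rw [coeff_add]
    exact add_nonneg (hp i) (hq i)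

theorem mul {p q : ℤ[X]} (hp : CoeffNonneg p) (hq : CoeffNonneg q) : CoeffNonneg (p * q) :=
  fun i => by
    rw [coeff_mul]
    exact sum_nonneg fun _ _ => mul_nonneg (hp _) (hq _)

end CoeffNonneg

/-- The subsemiring of the coefficientwise nonnegative polynomials, through which the general
results on total positivity are applied. -/
def coeffNonnegSubsemiring : Subsemiring ℤ[X] where
  carrier := {p | CoeffNonneg p}
  zero_mem' := CoeffNonneg.zero
  one_mem' := CoeffNonneg.one
  add_mem' := CoeffNonneg.add
  mul_mem' := CoeffNonneg.mul

theorem coeffTotallyPositive_iff {M : Matrix ℕ ℕ ℤ[X]} :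
    CoeffTotallyPositive M ↔ IsTotallyPositive coeffNonnegSubsemiring M :=
  Iff.rfl

theorem CoeffNonneg.qInt (n : ℕ) : CoeffNonneg (qInt n) :=
  coeffNonnegSubsemiring.sum_mem fun k _ => X_pow k

theorem qInt_succ (n : ℕ) : qInt (n + 1) = 1 + X * qInt n := by
  rw [add_comm, qInt_add]
  simp [qInt]

theorem qInt_succ_ne_zero (n : ℕ) : qInt (n + 1) ≠ 0 :=
  (monic_geom_sum_X n.succ_ne_zero).ne_zero

theorem qBinom_of_lt {n k : ℕ} (h : n < k) : qBinom n k = 0 :=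
  if_neg h.not_ge

theorem qBinom_self (n : ℕ) : qBinom n n = 1 :=
  mul_left_cancel₀ (monic_qFactorial n).ne_zero <| by
    simpa [qFactorial] using qBinom_mul (le_refl n)

theorem qBinom_zero_right (n : ℕ) : qBinom n 0 = 1 :=
  mul_left_cancel₀ (monic_qFactorial n).ne_zero <| by
    simpa [qFactorial] using qBinom_mul n.zero_le

theorem qInt_mul_qBinom_succ_succ (n k : ℕ) :
    qInt (k + 1) * qBinom (n + 1) (k + 1) = qInt (n + 1) * qBinom n k := by
  rcases lt_or_ge n k with h | h
  · rw [qBinom_of_lt h, qBinom_of_lt (by lia), mul_zero, mul_zero]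
  · have hn := qBinom_mul h
    have hn_succ := qBinom_mul (Nat.succ_le_succ h)
    simp only [Nat.succ_eq_add_one, Nat.add_sub_add_right, qFactorial_succ] at hn_succ
    refine mul_left_cancel₀ ((monic_qFactorial k).mul (monic_qFactorial (n - k))).ne_zero ?_
    linear_combination hn_succ - qInt (n + 1) * hn

theorem qInt_mul_qBinom_succ_left (k d : ℕ) :
    qInt (d + 1) * qBinom (k + d + 1) k = qInt (k + d + 1) * qBinom (k + d) k := by
  have hn := qBinom_mul (k.le_add_right d)
  have hn_succ := qBinom_mul (k.le_add_right (d + 1))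
  rw [Nat.add_sub_cancel_left] at hn hn_succ
  rw [← add_assoc, qFactorial_succ, qFactorial_succ] at hn_succ
  refine mul_left_cancel₀ ((monic_qFactorial k).mul (monic_qFactorial d)).ne_zero ?_
  linear_combination hn_succ - qInt (k + d + 1) * hn

theorem qBinom_succ_succ (n k : ℕ) :
    qBinom (n + 1) (k + 1) = qBinom n k + X ^ (k + 1) * qBinom n (k + 1) := by
  rcases lt_trichotomy n k with h | rfl | h
  · simp [qBinom_of_lt h, qBinom_of_lt (Nat.succ_lt_succ h), qBinom_of_lt (Nat.lt_succ_of_lt h)]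
  · simp [qBinom_self, qBinom_of_lt n.lt_succ_self]
  · obtain ⟨d, rfl⟩ := Nat.exists_eq_add_of_le (Nat.succ_le_of_lt h)
    have hdiag := qInt_mul_qBinom_succ_succ (k + 1 + d) k
    have hleft := qInt_mul_qBinom_succ_left (k + 1) d
    have hsplit : qInt (k + 1 + d + 1) = qInt (k + 1) + X ^ (k + 1) * qInt (d + 1) := by
      rw [← qInt_add, add_assoc]
    refine mul_left_cancel₀ (qInt_succ_ne_zero (k + 1 + d)) ?_
    linear_combination hdiag + X ^ (k + 1) * hleft + qBinom (k + 1 + d + 1) (k + 1) * hsplit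

/-- The `q`-trees matrix with `[n]_q` generalized to `y + z [n]_q` in the base of the power. -/
noncomputable def abelTrees (y z : ℤ[X]) : Matrix ℕ ℕ ℤ[X] :=
  Matrix.of fun n k => qBinom n k * (y + z * qInt n) ^ (n - k)

/-- The analogue of the `q`-forests matrix for `abelTrees y z`. Its entries below the diagonal are
`qBinom n k * (y + z [k]_q) * (y + z [n]_q) ^ (n - k - 1)`, which are `q`-analogues of the
coefficients of Abel polynomials; the definition as a difference of columns of `abelTrees y z`
avoids the exponent `-1` on the diagonal. -/
noncomputable def abelForests (y z : ℤ[X]) : Matrix ℕ ℕ ℤ[X] :=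
  Matrix.of fun n k =>
    abelTrees y z n k - z * X ^ k * qInt (k + 1) * abelTrees y z n (k + 1)

theorem abelTrees_of_lt (y z : ℤ[X]) {n k : ℕ} (h : n < k) : abelTrees y z n k = 0 := by
  simp [abelTrees, qBinom_of_lt h]

theorem abelTrees_eq_abelForests_add (y z : ℤ[X]) (n k : ℕ) :
    abelTrees y z n k =
      abelForests y z n k + z * X ^ k * qInt (k + 1) * abelTrees y z n (k + 1) := by
  simp [abelForests]

theorem abelForests_row_zero (y z : ℤ[X]) : abelForests y z 0 = Pi.single 0 1 := by
  funext k
  rcases k with _ | k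
  · simp [abelForests, abelTrees, qBinom_self, qBinom_of_lt]
  · simp [abelForests, abelTrees_of_lt]

theorem add_mul_qInt_succ (y z : ℤ[X]) (n : ℕ) :
    y + z * qInt (n + 1) = y + z + z * X * qInt n := by
  rw [qInt_succ]
  ring

theorem abelForests_succ_zero (y z : ℤ[X]) (n : ℕ) :
    abelForests y z (n + 1) 0 = y * abelTrees (y + z) (z * X) n 0 := by
  have habs := qInt_mul_qBinom_succ_succ n 0
  simp only [abelForests, abelTrees, Matrix.of_apply, ← add_mul_qInt_succ, qBinom_zero_right,
    zero_add, Nat.sub_zero, Nat.add_sub_cancel] at habs ⊢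
  linear_combination -z * (y + z * qInt (n + 1)) ^ n * habs

theorem abelForests_succ_succ (y z : ℤ[X]) (n k : ℕ) :
    abelForests y z (n + 1) (k + 1) = abelTrees (y + z) (z * X) n k +
      X ^ (k + 1) * y * abelTrees (y + z) (z * X) n (k + 1) := by
  simp only [abelForests, abelTrees, Matrix.of_apply, ← add_mul_qInt_succ, Nat.add_sub_add_right]
  rcases lt_or_ge n (k + 1) with h | h
  · simp [qBinom_of_lt h, qBinom_of_lt (Nat.succ_lt_succ h), qBinom_succ_succ n k]
  · obtain ⟨d, rfl⟩ := Nat.exists_eq_add_of_le h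
    have habs := qInt_mul_qBinom_succ_succ (k + 1 + d) (k + 1)
    have hexp : k + 1 + d - k = d + 1 := by lia
    rw [hexp, Nat.add_sub_cancel_left, qBinom_succ_succ (k + 1 + d) k]
    linear_combination -z * X ^ (k + 1) * (y + z * qInt (k + 1 + d + 1)) ^ d * habs

theorem abelTrees_initial_rows_isTotallyPositive {y z : ℤ[X]} (hz : CoeffNonneg z) {R : ℕ}
    (h : IsTotallyPositive coeffNonnegSubsemiring
      ((abelForests y z).submatrix (Fin.val : Fin R → ℕ) id)) :
    IsTotallyPositive coeffNonnegSubsemiring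
      ((abelTrees y z).submatrix (Fin.val : Fin R → ℕ) id) :=
  h.of_inverse_lower_bidiagonal (c := fun k => z * X ^ k * qInt (k + 1)) (K := R)
    (fun k => (hz.mul (.X_pow k)).mul (.qInt _))
    (fun a _ hk => abelTrees_of_lt y z (a.isLt.trans_le hk))
    fun a k => abelTrees_eq_abelForests_add y z a k

theorem abelForests_initial_rows_isTotallyPositive {y z : ℤ[X]} (hy : CoeffNonneg y)
    (hz : CoeffNonneg z) (R : ℕ) :
    IsTotallyPositive coeffNonnegSubsemiring
      ((abelForests y z).submatrix (Fin.val : Fin R → ℕ) id) := by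
  induction R generalizing y z with
  | zero =>
    intro r i j _ _
    rcases r with _ | r
    · simp
    · exact (i 0).elim0
  | succ R ih =>
    have hzX : CoeffNonneg (z * X) := by simpa using hz.mul (.X_pow 1)
    have hlower : IsTotallyPositive coeffNonnegSubsemiring
        (((abelForests y z).submatrix (Fin.val : Fin (R + 1) → ℕ) id).submatrix Fin.succ id) :=
      (abelTrees_initial_rows_isTotallyPositive hzX
        (ih (hy.add hz) hzX)).of_upper_bidiagonal (c := fun k => X ^ k * y)
        (fun k => (CoeffNonneg.X_pow k).mul hy)
        (fun a => by simp [abelForests_succ_zero]) fun a k => abelForests_succ_succ y z a k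
    exact .of_row_zero_eq_single (abelForests_row_zero y z) hlower

theorem abelTrees_zero_one : abelTrees 0 1 = qTrees := by
  simp [abelTrees, qTrees]

theorem abelForests_zero_one : abelForests 0 1 = qForests := by
  ext1 n k
  rcases n with _ | n
  · rcases k with _ | k <;> simp [abelForests_row_zero, qForests]
  rcases k with _ | k
  · simp [abelForests_succ_zero, qForests]
  · rw [abelForests_succ_succ, mul_zero, zero_mul, add_zero]
    rcases le_or_gt k n with h | h
    · simp [abelTrees, qForests, qInt_succ, h]
    · simp [abelTrees_of_lt, qForests, h, h.not_ge]

end QForests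

open QForests in
theorem theorem1p2_general {y z : ℤ[X]} (hy : CoeffNonneg y) (hz : CoeffNonneg z) :
    CoeffTotallyPositive (abelForests y z) ∧ CoeffTotallyPositive (abelTrees y z) := by
  have hforests := abelForests_initial_rows_isTotallyPositive hy hz
  exact ⟨coeffTotallyPositive_iff.2 (.of_initial_rows hforests),
    coeffTotallyPositive_iff.2 (.of_initial_rows fun R =>
      abelTrees_initial_rows_isTotallyPositive hz (hforests R))⟩

/-- The `q`-forests matrix and the `q`-trees matrix are coefficientwise totally positive. -/
theorem theorem1p2 :
    QForests.CoeffTotallyPositive QForests.qForests ∧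
      QForests.CoeffTotallyPositive QForests.qTrees := by
  rw [← QForests.abelForests_zero_one, ← QForests.abelTrees_zero_one]
  exact theorem1p2_general .zero .one
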